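/- Let $n \ge 4$, let $S_n$ be the symmetric group on $\{1,\dots,n\}$, and let $$\mathcal R'_n(2) = \{(1,2,3),\ (1,3,2),\ (1,3),\ (1,2)(3,4),\ (1,2)(4,5),\ \dots,\ (1,2)(n-1,n)\} \subset S_n .$$ (These are the permutations $\sigma$ with $\sigma(1)\neq 1$ for which $n-2$ is the largest $m$ such that $\{1,\dots,n\}$ can be partitioned into $m$ intervals of consecutive integers, each mapped onto itself by $\sigma$.) Let $\Gamma_n = \operatorname{Cay}(S_n, \mathcal R'_n(2))$ be the graph with vertex set $S_n$ in which $g$ and $h$ are adjacent if and only if $h = \sigma g$ for some $\sigma \in \mathcal R'_n(2)$. The left cosets $V_i = (1\,i)\operatorname{Stab}(1)$, $1 \le i \le n$, of the stabiliser of the symbol $1$ form an equitable partition of $\Gamma_n$: for all $i,j$, every vertex in $V_i$ has the same number $q_{ij}$ of neighbours in $V_j$. Let $\mathsf Q'_n = (q_{ij})_{1 \le i,j \le n}$ be the corresponding quotient matrix, which is symmetric. Then $$\lambda_2(\Gamma_n) = \lambda_2(\mathsf Q'_n),$$ where $\lambda_2(M)$ denotes the second largest eigenvalue, counted with multiplicity,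 of a real symmetric matrix $M$, and $\lambda_2(\Gamma_n)$ is that of the adjacency matrix of $\Gamma_n$. -/

import Mathlib

namespace FlagJohnson

/-! ### Cayley graphs (generators act by left multiplication) -/

/-- The Cayley graph `Cay(G, S)` of an inverse-closed set `S` not containing the identity:
`g` and `h` are adjacent when `h = σ * g` for some `σ ∈ S`. -/
def cayleyGraph {G : Type*} [Group G] (S : Set G) (hone : (1 : G) ∉ S)
    (hinv : ∀ g ∈ S, g⁻¹ ∈ S) : SimpleGraph G where
  Adj g h := ∃ σ ∈ S, h = σ * g
  symm := ⟨by
    rintro g h ⟨σ, hσ, rfl⟩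
    exact ⟨σ⁻¹, hinv σ hσ, by simp⟩⟩
  loopless := ⟨by
    rintro g ⟨σ, hσ, h⟩
    have h1 : σ = 1 := by simpa using h.symm
    exact hone (h1 ▸ hσ)⟩

/-! ### Equitable partitions and quotient matrices -/

/-- The indexed family `V` of cells is an equitable partition of the vertex set of `Γ`: the cells
are non-empty, every vertex lies in exactly one of them, and for all `i j` every vertex of `V i`
has the same number of neighbours in `V j`. -/
structure IsEquitablePartition {W ι : Type*} (Γ : SimpleGraph W) (V : ι → Set W) : Prop where
  nonempty : ∀ i, (V i).Nonempty
  existsUnique_mem : ∀ v, ∃! i, v ∈ V i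
  card_eq : ∀ i j, ∀ v ∈ V i, ∀ w ∈ V i,
    (Γ.neighborSet v ∩ V j).ncard = (Γ.neighborSet w ∩ V j).ncard

/-- The quotient matrix: its `(i, j)` entry is the number of neighbours in `V j` of a vertex of
`V i` (the same for every such vertex, see `quotientMatrix_apply`). -/
noncomputable def quotientMatrix {W ι : Type*} {Γ : SimpleGraph W} {V : ι → Set W}
    (hV : IsEquitablePartition Γ V) : Matrix ι ι ℝ :=
  fun i j => ((Γ.neighborSet (hV.nonempty i).some ∩ V j).ncard : ℝ)

theorem quotientMatrix_apply {W ι : Type*} {Γ : SimpleGraph W} {V : ι → Set W}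
    (hV : IsEquitablePartition Γ V) (i j : ι) {v : W} (hv : v ∈ V i) :
    quotientMatrix hV i j = ((Γ.neighborSet v ∩ V j).ncard : ℝ) := by
  unfold quotientMatrix
  rw [hV.card_eq i j _ (hV.nonempty i).some_mem v hv]

/-! ### The second largest eigenvalue -/

/-- `λ₂(M)`, where `λ₁(M) ≥ λ₂(M) ≥ ⋯` are the eigenvalues of the real symmetric matrix `M`,
listed with multiplicity; the matrix has at least two rows. (`eigenvalues₀` is the
non-increasing list of the eigenvalues, numbered from `0`.) -/
noncomputable def secondEigenvalue {ι : Type*} [Fintype ι] [DecidableEq ι] (M : Matrix ι ι ℝ)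
    (hM : M.IsHermitian) (hι : 1 < Fintype.card ι) : ℝ :=
  hM.eigenvalues₀ ⟨1, hι⟩

open Classical in
theorem isHermitian_adjMatrix {W : Type*} (Γ : SimpleGraph W) :
    (Γ.adjMatrix ℝ).IsHermitian := by
  rw [Matrix.IsHermitian, Matrix.conjTranspose_eq_transpose_of_trivial]
  exact Γ.isSymm_adjMatrix

open Classical in
/-- `λ₂(Γ)`: the second largest eigenvalue of the adjacency matrix of the graph `Γ`. -/
noncomputable def graphSecondEigenvalue {W : Type*} [Fintype W] (Γ : SimpleGraph W)
    (hW : 1 < Fintype.card W) : ℝ :=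
  secondEigenvalue (Γ.adjMatrix ℝ) (isHermitian_adjMatrix Γ) hW

/-! ### The generating set

The symmetric group `S_n` is `Equiv.Perm (Fin n)`; the symbol `k` of `{1, …, n}` is the element
of `Fin n` with value `k - 1`. -/

/-- The symbol `k`, for `1 ≤ k ≤ n`, as an element of `Fin n`. -/
def symbol {n : ℕ} (k : ℕ) (hk : 1 ≤ k ∧ k ≤ n) : Fin n := ⟨k - 1, by omega⟩

/-- The set `{(1,2,3), (1,3,2), (1,3), (1,2)(3,4), (1,2)(4,5), …, (1,2)(n-1,n)}`. -/
def generators {n : ℕ} (hn : 4 ≤ n) : Set (Equiv.Perm (Fin n)) :=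
  let s₁ : Fin n := symbol 1 ⟨by omega, by omega⟩
  let s₂ : Fin n := symbol 2 ⟨by omega, by omega⟩
  let s₃ : Fin n := symbol 3 ⟨by omega, by omega⟩
  {List.formPerm [s₁, s₂, s₃], List.formPerm [s₁, s₃, s₂], Equiv.swap s₁ s₃} ∪
    {σ | ∃ (k : ℕ) (hk : 3 ≤ k ∧ k + 1 ≤ n), σ = Equiv.swap s₁ s₂ *
      Equiv.swap (symbol k ⟨by omega, by omega⟩) (symbol (k + 1) ⟨by omega, by omega⟩)}

theorem one_notMem_generators {n : ℕ} (hn : 4 ≤ n) : 1 ∉ generators hn := by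
  intro h
  have hne : ∀ σ ∈ generators hn, σ (symbol 1 ⟨by omega, by omega⟩) ≠
      symbol 1 ⟨by omega, by omega⟩ := by
    rintro σ ((rfl | rfl | rfl) | ⟨k, hk, rfl⟩)
    · simp [List.formPerm_cons_cons, Equiv.swap_apply_def, symbol]
    · simp [List.formPerm_cons_cons, Equiv.swap_apply_def, symbol]
    · simp [symbol]
    · have h1 : ¬ 0 = k - 1 := by omega
      have h2 : ¬ 0 = k := by omega
      simp [Equiv.swap_apply_def, symbol, h1, h2]
  exact hne 1 h rfl

theorem formPerm_triple_inv {α : Type*} [DecidableEq α] {a b c : α} (hab : a ≠ b) (hbc : b ≠ c)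
    (hac : a ≠ c) : (List.formPerm [a, b, c])⁻¹ = List.formPerm [a, c, b] := by
  rw [inv_eq_iff_mul_eq_one]
  ext x
  simp only [List.formPerm_cons_cons, List.formPerm_singleton, mul_one, Equiv.Perm.mul_apply,
    Equiv.Perm.one_apply, Equiv.swap_apply_def]
  grind

theorem inv_mem_generators {n : ℕ} (hn : 4 ≤ n) :
    ∀ σ ∈ generators hn, σ⁻¹ ∈ generators hn := by
  rintro σ ((rfl | rfl | rfl) | ⟨k, hk, rfl⟩)
  · exact Or.inl (Or.inr (Or.inl
      (formPerm_triple_inv (by simp [symbol]) (by simp [symbol]) (by simp [symbol]))))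
  · exact Or.inl (Or.inl
      (formPerm_triple_inv (by simp [symbol]) (by simp [symbol]) (by simp [symbol])))
  · exact Or.inl (Or.inr (Or.inr (Equiv.swap_inv _ _)))
  · refine Or.inr ⟨k, hk, ?_⟩
    rw [mul_inv_rev, Equiv.swap_inv, Equiv.swap_inv]
    ext x
    simp only [Equiv.Perm.mul_apply, Equiv.swap_apply_def, symbol, Fin.ext_iff]
    grind

/-- The Cayley graph of `S_n` with respect to `generators`. -/
def cayleyGenerators {n : ℕ} (hn : 4 ≤ n) : SimpleGraph (Equiv.Perm (Fin n)) :=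
  cayleyGraph (generators hn) (one_notMem_generators hn) (inv_mem_generators hn)

/-! ### The point-stabiliser partition -/

/-- The left coset `(1 i) Stab(1)`. -/
def cosetCell {n : ℕ} (hn : 4 ≤ n) (i : Fin n) : Set (Equiv.Perm (Fin n)) :=
  {g | ∃ h ∈ MulAction.stabilizer (Equiv.Perm (Fin n)) (symbol 1 ⟨by omega, by omega⟩ : Fin n),
    g = Equiv.swap (symbol 1 ⟨by omega, by omega⟩) i * h}

theorem mem_cosetCell {n : ℕ} (hn : 4 ≤ n) (i : Fin n) (g : Equiv.Perm (Fin n)) :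
    g ∈ cosetCell hn i ↔ g (symbol 1 ⟨by omega, by omega⟩) = i := by
  constructor
  · rintro ⟨h, hh, rfl⟩
    have h1 : h (symbol 1 ⟨by omega, by omega⟩) = symbol 1 ⟨by omega, by omega⟩ := hh
    simp [h1]
  · intro hg
    refine ⟨Equiv.swap (symbol 1 ⟨by omega, by omega⟩) i * g, ?_, ?_⟩
    · rw [MulAction.mem_stabilizer_iff]
      simp [hg]
    · simp [← mul_assoc]

/-- The number of neighbours of a vertex `v` of the cell of `i` in the cell of `j`. -/
theorem ncard_neighborSet_inter {n : ℕ} (hn : 4 ≤ n) (i j : Fin n) (v : Equiv.Perm (Fin n))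
    (hv : v ∈ cosetCell hn i) :
    ((cayleyGenerators hn).neighborSet v ∩ cosetCell hn j).ncard =
      {σ | σ ∈ generators hn ∧ σ i = j}.ncard := by
  rw [mem_cosetCell] at hv
  rw [← Set.ncard_image_of_injective {σ | σ ∈ generators hn ∧ σ i = j} (mul_left_injective v)]
  congr 1
  ext g
  simp only [Set.mem_inter_iff, SimpleGraph.mem_neighborSet, mem_cosetCell, Set.mem_image,
    Set.mem_ofPred_eq]
  constructor
  · rintro ⟨⟨σ, hσ, rfl⟩, hj⟩
    exact ⟨σ, ⟨hσ, by simpa [hv] using hj⟩, rfl⟩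
  · rintro ⟨σ, ⟨hσ, hj⟩, rfl⟩
    exact ⟨⟨σ, hσ, rfl⟩, by simpa [hv] using hj⟩

theorem isEquitablePartition_cosetCell {n : ℕ} (hn : 4 ≤ n) :
    IsEquitablePartition (cayleyGenerators hn) (cosetCell hn) where
  nonempty i := ⟨Equiv.swap (symbol 1 ⟨by omega, by omega⟩) i, by simp [mem_cosetCell]⟩
  existsUnique_mem v := by simp [mem_cosetCell]
  card_eq i j v hv w hw := by
    rw [ncard_neighborSet_inter hn i j v hv, ncard_neighborSet_inter hn i j w hw]

/-- The quotient matrix of the Cayley graph with respect to the partition into left cosets of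
the stabiliser of the symbol `1`. -/
noncomputable def quotientQ {n : ℕ} (hn : 4 ≤ n) : Matrix (Fin n) (Fin n) ℝ :=
  quotientMatrix (isEquitablePartition_cosetCell hn)

theorem quotientQ_apply {n : ℕ} (hn : 4 ≤ n) (i j : Fin n) :
    quotientQ hn i j = ({σ | σ ∈ generators hn ∧ σ i = j}.ncard : ℝ) := by
  obtain ⟨v, hv⟩ := (isEquitablePartition_cosetCell hn).nonempty i
  rw [quotientQ, quotientMatrix_apply _ i j hv, ncard_neighborSet_inter hn i j v hv]

theorem isHermitian_quotientQ {n : ℕ} (hn : 4 ≤ n) : (quotientQ hn).IsHermitian := by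
  ext i j
  simp only [Matrix.conjTranspose_apply, star_trivial, quotientQ_apply]
  congr 1
  rw [← Set.ncard_image_of_injective {σ | σ ∈ generators hn ∧ σ j = i} inv_injective]
  congr 1
  ext g
  simp only [Set.mem_image, Set.mem_ofPred_eq]
  constructor
  · rintro ⟨σ, ⟨hσ, h⟩, rfl⟩
    exact ⟨inv_mem_generators hn σ hσ, by simp [← h]⟩
  · rintro ⟨hg, h⟩
    exact ⟨g⁻¹, ⟨inv_mem_generators hn g hg, by simp [← h]⟩, inv_inv g⟩

/-! ### The matrices are large enough to have a second eigenvalue -/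

theorem one_lt_card_fin {n : ℕ} (hn : 4 ≤ n) : 1 < Fintype.card (Fin n) := by
  rw [Fintype.card_fin]
  omega

theorem one_lt_card_perm {n : ℕ} (hn : 4 ≤ n) : 1 < Fintype.card (Equiv.Perm (Fin n)) := by
  rw [Fintype.card_perm, Fintype.card_fin]
  exact lt_of_lt_of_le (by omega) (Nat.self_le_factorial n)

end FlagJohnson

namespace FlagJohnson

open Matrix Equiv

/-! ### Second eigenvalue of a symmetric matrix with constant row sums -/

section Spectral

variable {ι : Type*} [Fintype ι] [DecidableEq ι]

/-! The inequality `λ₂(Q) ≤ λ₂(Γ)` comes from lifting an eigenvector `w` of the quotient to `g ↦ w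
(g 0)`. The converse is an induction on `n`. Let `f` be a `λ₂(Γ_n)`-eigenvector with sum zero. If
`f` has a nonzero sum over some coset `{g | g i = n}`, then pushing `f` forward along `g ↦ g i`
gives a sum-zero eigenvector of the quotient matrix, so `λ₂(Γ_n) ≤ λ₂(Q_n)`. Otherwise `f` has sum
zero on every right coset of `Stab(n)`. All generators but `(1,2)(n-1,n)` lie in `Stab(n)` and
generate there a copy of the previous Cayley graph, and the remaining one adds at most `1` to the
Rayleigh quotient; hence `λ₂(Γ_n) ≤ λ₂(Γ_{n-1}) + 1`.

It remains to show `λ₂(Q_{n-1}) + 1 ≤ λ₂(Q_n)` (`quotientEigenvalue_add_one_le`), by testing `Q_n`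
on an eigenvector of `Q_{n-1}` with its last entry repeated; the error `(w 0 - w 1)²` is controlled
by `sq_sub_le_of_recurrence`. The induction starts from `S_3`, where the bound is `1`
(`form_le_of_symm_three`). -/

theorem exists_spectral_decomposition (M : Matrix ι ι ℝ) (hM : M.IsHermitian)
    (hι : 1 < Fintype.card ι) :
    ∃ (x : ι → ι → ℝ) (ev : ι → ℝ) (a b : ι), a ≠ b ∧ ev b = secondEigenvalue M hM hι ∧
      secondEigenvalue M hM hι ≤ ev a ∧ (∀ i, i ≠ a → ev i ≤ secondEigenvalue M hM hι) ∧
      (∀ i, M *ᵥ x i = ev i • x i) ∧ (∀ i j, x i ⬝ᵥ x j = if i = j then 1 else 0) ∧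
      ∀ v w, v ⬝ᵥ w = ∑ i, (x i ⬝ᵥ v) * (x i ⬝ᵥ w) := by
  let e : Fin (Fintype.card ι) ≃ ι := Fintype.equivOfCardEq (Fintype.card_fin _)
  have hev : ∀ k, hM.eigenvalues (e k) = hM.eigenvalues₀ k := by
    intro k
    simp [Matrix.IsHermitian.eigenvalues, e]
  refine ⟨fun i => (hM.eigenvectorBasis i).ofLp, hM.eigenvalues, e ⟨0, by omega⟩, e ⟨1, hι⟩,
    ?_, ?_, ?_, ?_, ?_, ?_, ?_⟩
  · intro h
    simpa using e.injective h
  · rw [hev]; rfl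
  · rw [hev]
    exact hM.eigenvalues₀_antitone (by simp [Fin.le_def])
  · intro i hi
    obtain ⟨k, rfl⟩ := e.surjective i
    rw [hev]
    refine hM.eigenvalues₀_antitone ?_
    rw [Fin.le_def]
    have : k ≠ ⟨0, by omega⟩ := fun h => hi (by rw [h])
    rw [Ne, Fin.ext_iff] at this
    simp only at this ⊢
    omega
  · intro i
    exact hM.mulVec_eigenvectorBasis i
  · intro i j
    have := (orthonormal_iff_ite.mp hM.eigenvectorBasis.orthonormal) i j
    rw [← this, EuclideanSpace.inner_eq_star_dotProduct, dotProduct_comm]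
    simp
  · intro v w
    have := hM.eigenvectorBasis.sum_inner_mul_inner (WithLp.toLp 2 v) (WithLp.toLp 2 w)
    simp only [EuclideanSpace.inner_eq_star_dotProduct, star_trivial] at this
    rw [dotProduct_comm, ← this]
    exact Finset.sum_congr rfl fun i _ => by
      rw [dotProduct_comm w]

variable {M : Matrix ι ι ℝ} (hM : M.IsHermitian) (hι : 1 < Fintype.card ι) {r : ℝ}
  (hr : M *ᵥ 1 = r • 1) (hb : ∀ v : ι → ℝ, v ⬝ᵥ M *ᵥ v ≤ r * (v ⬝ᵥ v))

omit [DecidableEq ι] in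
theorem dotProduct_mulVec_symm {M : Matrix ι ι ℝ} (hM : M.IsHermitian) (v w : ι → ℝ) :
    v ⬝ᵥ M *ᵥ w = (M *ᵥ v) ⬝ᵥ w := by
  rw [dotProduct_mulVec, ← mulVec_transpose]
  congr 2

include hr hb in
-- No connectedness is needed: if the second basis vector is not orthogonal to the constants, then
-- `r` is at least a double eigenvalue.
theorem exists_eigenvector_secondEigenvalue :
    ∃ w : ι → ℝ, w ≠ 0 ∧ ∑ i, w i = 0 ∧ M *ᵥ w = secondEigenvalue M hM hι • w := by
  obtain ⟨x, ev, a, b, hab, hevb, heva, hev, hx, ho, hs⟩ :=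
    exists_spectral_decomposition M hM hι
  have hsum : ∀ w : ι → ℝ, ∑ i, w i = w ⬝ᵥ 1 := fun w => by simp [dotProduct]
  have hc : ∀ i, ev i * (x i ⬝ᵥ 1) = r * (x i ⬝ᵥ 1) := by
    intro i
    have := dotProduct_mulVec_symm hM (x i) 1
    rw [hr, hx] at this
    simpa [dotProduct_smul, smul_dotProduct] using this.symm
  simp only [hsum]
  by_cases h : x b ⬝ᵥ 1 = 0
  · refine ⟨x b, ?_, h, by rw [hx, hevb]⟩
    intro h0
    have := ho b b
    simp [h0] at this
  · have hb1 : ev b = r := mul_right_cancel₀ h (hc b)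
    have ha1 : ev a ≤ r := by
      have := hb (x a)
      rw [hx, dotProduct_smul, ho] at this
      simpa using this
    have ha2 : ev a = r := by linarith
    -- Both vectors lie in the `r`-eigenspace; this combination is the one orthogonal to the
    -- constants.
    refine ⟨(x b ⬝ᵥ 1) • x a - (x a ⬝ᵥ 1) • x b, ?_, ?_, ?_⟩
    · intro h0
      have h1 : x a ⬝ᵥ ((x b ⬝ᵥ 1) • x a - (x a ⬝ᵥ 1) • x b) = x b ⬝ᵥ 1 := by
        rw [dotProduct_sub, dotProduct_smul, dotProduct_smul, ho, ho]
        simp [hab]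
      rw [h0, dotProduct_zero] at h1
      exact h h1.symm
    · simp only [sub_dotProduct, smul_dotProduct, smul_eq_mul]
      ring
    · rw [mulVec_sub, mulVec_smul, mulVec_smul, hx, hx, ha2, ← hevb, hb1, smul_sub]
      simp only [smul_smul, mul_comm]

include hr hb in
theorem dotProduct_mulVec_le_secondEigenvalue {v : ι → ℝ} (hv : ∑ i, v i = 0) :
    v ⬝ᵥ M *ᵥ v ≤ secondEigenvalue M hM hι * (v ⬝ᵥ v) := by
  obtain ⟨x, ev, a, b, hab, hevb, heva, hev, hx, ho, hs⟩ :=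
    exists_spectral_decomposition M hM hι
  have hvv : 0 ≤ v ⬝ᵥ v := by
    rw [hs]
    exact Finset.sum_nonneg fun i _ => mul_self_nonneg _
  rcases le_or_gt r (secondEigenvalue M hM hι) with h | h
  · exact (hb v).trans (mul_le_mul_of_nonneg_right h hvv)
  have hc : ∀ i, ev i * (x i ⬝ᵥ 1) = r * (x i ⬝ᵥ 1) := by
    intro i
    have := dotProduct_mulVec_symm hM (x i) 1
    rw [hr, hx] at this
    simpa [dotProduct_smul, smul_dotProduct] using this.symm
  -- Now `r` exceeds `λ₂`, so the constants are spanned by `x a` and a sum-zero vector has no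
  -- component along it.
  have hc0 : ∀ i, i ≠ a → x i ⬝ᵥ 1 = 0 := by
    intro i hi
    by_contra h0
    have := mul_right_cancel₀ h0 (hc i)
    linarith [hev i hi]
  have hsingle : ∀ w : ι → ℝ, w ⬝ᵥ 1 = (x a ⬝ᵥ w) * (x a ⬝ᵥ 1) := by
    intro w
    rw [hs]
    exact Finset.sum_eq_single a (fun i _ hi => by rw [hc0 i hi, mul_zero]) (by simp)
  have hca : x a ⬝ᵥ 1 ≠ 0 := by
    intro h0
    have h1 := hsingle 1
    rw [h0, mul_zero] at h1
    simp [dotProduct] at h1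
    omega
  have hva : x a ⬝ᵥ v = 0 := by
    have h1 := hsingle v
    have h2 : v ⬝ᵥ 1 = 0 := by simpa [dotProduct] using hv
    rw [h2] at h1
    exact (mul_eq_zero.mp h1.symm).resolve_right hca
  rw [hs v (M *ᵥ v), hs v v, Finset.mul_sum]
  refine Finset.sum_le_sum fun i _ => ?_
  rw [dotProduct_mulVec_symm hM, hx, smul_dotProduct, smul_eq_mul]
  by_cases hi : i = a
  · rw [hi, hva]; simp
  · nlinarith [hev i hi, mul_self_nonneg (x i ⬝ᵥ v)]

include hr hb in
/-- The Rayleigh bound for a vector that need not be orthogonal to the constants. -/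
theorem dotProduct_mulVec_le_of_sum (v : ι → ℝ) :
    v ⬝ᵥ M *ᵥ v ≤ secondEigenvalue M hM hι * (v ⬝ᵥ v) +
      (r - secondEigenvalue M hM hι) * (∑ i, v i) ^ 2 / Fintype.card ι := by
  have hN : (Fintype.card ι : ℝ) ≠ 0 := by
    have : 0 < Fintype.card ι := by omega
    positivity
  set s := ∑ i, v i with hsdef
  set N : ℝ := (Fintype.card ι : ℝ) with hNdef
  have h11 : (1 : ι → ℝ) ⬝ᵥ 1 = N := by simp [dotProduct, hNdef]
  have hv1 : v ⬝ᵥ 1 = s := by simp [dotProduct, hsdef]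
  have h1v : 1 ⬝ᵥ v = s := by rw [dotProduct_comm, hv1]
  have hz : ∑ i, (v - (s / N) • (1 : ι → ℝ)) i = 0 := by
    have : ∑ i, (v - (s / N) • (1 : ι → ℝ)) i = (v - (s / N) • (1 : ι → ℝ)) ⬝ᵥ 1 := by
      simp [dotProduct]
    rw [this, sub_dotProduct, smul_dotProduct, h11, hv1, smul_eq_mul]
    field_simp
    ring
  have h := dotProduct_mulVec_le_secondEigenvalue hM hι hr hb hz
  have h1M : (1 : ι → ℝ) ⬝ᵥ M *ᵥ v = r * s := by
    rw [dotProduct_mulVec_symm hM, hr, smul_dotProduct, h1v, smul_eq_mul]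
  simp only [mulVec_sub, mulVec_smul, hr, sub_dotProduct, dotProduct_sub, smul_dotProduct,
    dotProduct_smul, h11, hv1, h1v, h1M, smul_eq_mul] at h
  have e1 : s - s / N * N = 0 := by field_simp; ring
  rw [e1] at h
  calc v ⬝ᵥ M *ᵥ v ≤ secondEigenvalue M hM hι * (v ⬝ᵥ v - s / N * s - s / N * 0) +
        (s / N * (r * s) + s / N * (r * 0)) := by linarith
    _ = _ := by ring

end Spectral

/-! ### The generators as a recursively defined finite set -/

/-- The embedding of the permutations of `Fin n` as the permutations of `Fin (n + 1)` fixing the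
last symbol. -/
noncomputable def fixLast (n : ℕ) : Perm (Fin n) →* Perm (Fin (n + 1)) :=
  Perm.viaEmbeddingHom Fin.castSuccEmb

theorem fixLast_injective (n : ℕ) : Function.Injective (fixLast n) :=
  Perm.viaEmbeddingHom_injective _

@[simp]
theorem fixLast_castSucc {n : ℕ} (σ : Perm (Fin n)) (i : Fin n) :
    fixLast n σ i.castSucc = (σ i).castSucc :=
  Perm.viaEmbedding_apply σ Fin.castSuccEmb i

@[simp]
theorem fixLast_last {n : ℕ} (σ : Perm (Fin n)) : fixLast n σ (Fin.last n) = Fin.last n :=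
  Perm.viaEmbedding_apply_of_notMem σ Fin.castSuccEmb _ (by simp)

theorem fixLast_swap {n : ℕ} (i j : Fin n) :
    fixLast n (swap i j) = swap i.castSucc j.castSucc := by
  ext x
  refine Fin.lastCases ?_ (fun y => ?_) x
  · rw [fixLast_last, swap_apply_of_ne_of_ne (Fin.castSucc_ne_last i).symm
      (Fin.castSucc_ne_last j).symm]
  · rw [fixLast_castSucc, swap_apply_def, swap_apply_def]
    simp only [Fin.castSucc_inj]
    split_ifs <;> rfl

/-- `(1,2)(n-1,n)` for `n = m + 4`. -/
def doubleSwap (m : ℕ) : Perm (Fin (m + 4)) :=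
  swap ⟨0, by omega⟩ ⟨1, by omega⟩ * swap ⟨m + 2, by omega⟩ ⟨m + 3, by omega⟩

/-- The generators of the Cayley graph for `n = m + 3`, including the case `n = 3`. -/
noncomputable def gens : (m : ℕ) → Finset (Perm (Fin (m + 3)))
  | 0 => {swap 0 1 * swap 1 2, swap 0 2 * swap 2 1, swap 0 2}
  | m + 1 => insert (doubleSwap m) ((gens m).map ⟨fixLast (m + 3), fixLast_injective _⟩)

theorem doubleSwap_last (m : ℕ) : doubleSwap m (Fin.last (m + 3)) = ⟨m + 2, by omega⟩ := by
  have h : Fin.last (m + 3) = ⟨m + 3, by omega⟩ := rfl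
  rw [doubleSwap, Perm.mul_apply, h, swap_apply_right,
    swap_apply_of_ne_of_ne (by simp) (by simp)]

theorem sum_gens_succ {β : Type*} [AddCommMonoid β] (m : ℕ) (F : Perm (Fin (m + 4)) → β) :
    ∑ σ ∈ gens (m + 1), F σ = F (doubleSwap m) + ∑ σ ∈ gens m, F (fixLast (m + 3) σ) := by
  rw [gens, Finset.sum_insert, Finset.sum_map]
  · rfl
  · rw [Finset.mem_map]
    rintro ⟨σ, -, h⟩
    have h1 := congrArg (fun τ => τ (Fin.last (m + 3))) h
    simp only [Function.Embedding.coeFn_mk, fixLast_last, doubleSwap_last] at h1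
    rw [Fin.ext_iff] at h1
    simp at h1

theorem sum_gens_zero {β : Type*} [AddCommMonoid β] (F : Perm (Fin 3) → β) :
    ∑ σ ∈ gens 0, F σ = F (swap 0 1 * swap 1 2) + (F (swap 0 2 * swap 2 1) + F (swap 0 2)) := by
  rw [gens, Finset.sum_insert (by decide), Finset.sum_insert (by decide), Finset.sum_singleton]

theorem card_gens (m : ℕ) : (gens m).card = m + 3 := by
  induction m with
  | zero => rfl
  | succ m ih => rw [Finset.card_eq_sum_ones, sum_gens_succ, ← Finset.card_eq_sum_ones, ih]; omega

theorem mem_gens (m : ℕ) (σ : Perm (Fin (m + 3))) : σ ∈ gens m ↔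
    (σ = swap ⟨0, by omega⟩ ⟨1, by omega⟩ * swap ⟨1, by omega⟩ ⟨2, by omega⟩ ∨
      σ = swap ⟨0, by omega⟩ ⟨2, by omega⟩ * swap ⟨2, by omega⟩ ⟨1, by omega⟩ ∨
      σ = swap ⟨0, by omega⟩ ⟨2, by omega⟩) ∨
    ∃ (k : ℕ) (hk : 3 ≤ k ∧ k + 1 ≤ m + 3), σ = swap ⟨0, by omega⟩ ⟨1, by omega⟩ *
      swap ⟨k - 1, by omega⟩ ⟨k, by omega⟩ := by
  induction m with
  | zero =>
    have : ¬ ∃ (k : ℕ) (hk : 3 ≤ k ∧ k + 1 ≤ 0 + 3), σ = swap ⟨0, by omega⟩ ⟨1, by omega⟩ *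
      swap ⟨k - 1, by omega⟩ ⟨k, by omega⟩ := by
      rintro ⟨k, hk, -⟩
      omega
    simp only [this, or_false, gens, Finset.mem_insert, Finset.mem_singleton]
    rfl
  | succ m ih =>
    simp only [gens, Finset.mem_insert, Finset.mem_map, Function.Embedding.coeFn_mk, ih]
    constructor
    · rintro (rfl | ⟨τ, ((rfl | rfl | rfl) | ⟨k, hk, rfl⟩), rfl⟩)
      · exact Or.inr ⟨m + 3, by omega, rfl⟩
      · left; left; simp [fixLast_swap]
      · left; right; left; simp [fixLast_swap]
      · left; right; right; simp [fixLast_swap]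
      · exact Or.inr ⟨k, by omega, by simp [fixLast_swap]⟩
    · rintro ((rfl | rfl | rfl) | ⟨k, hk, rfl⟩)
      · exact Or.inr ⟨_, Or.inl (Or.inl rfl), by simp [fixLast_swap]⟩
      · exact Or.inr ⟨_, Or.inl (Or.inr (Or.inl rfl)), by simp [fixLast_swap]⟩
      · exact Or.inr ⟨_, Or.inl (Or.inr (Or.inr rfl)), by simp [fixLast_swap]⟩
      · by_cases hkm : k = m + 3
        · subst hkm
          exact Or.inl rfl
        · exact Or.inr ⟨_, Or.inr ⟨k, by omega, rfl⟩, by simp [fixLast_swap]⟩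

theorem generators_eq_gens (m : ℕ) (hn : 4 ≤ m + 4) :
    generators hn = (gens (m + 1) : Set (Perm (Fin (m + 4)))) := by
  ext σ
  rw [Finset.mem_coe, mem_gens]
  simp [generators, symbol, List.formPerm_cons_cons, or_assoc]

/-! ### The quotient matrix and the adjacency matrix as averaging operators -/

theorem quotientQ_mulVec {m : ℕ} (hn : 4 ≤ m + 4) (v : Fin (m + 4) → ℝ) (i : Fin (m + 4)) :
    (quotientQ hn *ᵥ v) i = ∑ σ ∈ gens (m + 1), v (σ i) := by
  classical
  rw [← Finset.sum_fiberwise_of_maps_to (s := gens (m + 1)) (t := Finset.univ)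
    (g := fun σ => σ i) (fun _ _ => Finset.mem_univ _) (fun σ => v (σ i))]
  rw [mulVec, dotProduct]
  refine Finset.sum_congr rfl fun j _ => ?_
  rw [quotientQ_apply, generators_eq_gens]
  have : {σ | σ ∈ (gens (m + 1) : Set (Perm (Fin (m + 4)))) ∧ σ i = j} =
      ((gens (m + 1)).filter (fun σ => σ i = j) : Finset _) := by
    ext σ; simp
  rw [this, Set.ncard_coe_finset, Finset.sum_congr rfl (g := fun _ => v j), Finset.sum_const,
    nsmul_eq_mul]
  intro σ hσ
  rw [(Finset.mem_filter.mp hσ).2]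

open Classical in
theorem adjMatrix_mulVec {m : ℕ} (hn : 4 ≤ m + 4) (f : Perm (Fin (m + 4)) → ℝ)
    (g : Perm (Fin (m + 4))) :
    ((cayleyGenerators hn).adjMatrix ℝ *ᵥ f) g = ∑ σ ∈ gens (m + 1), f (σ * g) := by
  rw [SimpleGraph.adjMatrix_mulVec_apply]
  have : (cayleyGenerators hn).neighborFinset g =
      (gens (m + 1)).map ⟨fun σ => σ * g, mul_left_injective g⟩ := by
    ext h
    simp only [SimpleGraph.mem_neighborFinset, Finset.mem_map, Function.Embedding.coeFn_mk]
    constructor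
    · rintro ⟨σ, hσ, rfl⟩
      rw [generators_eq_gens] at hσ
      exact ⟨σ, hσ, rfl⟩
    · rintro ⟨σ, hσ, rfl⟩
      refine ⟨σ, ?_, rfl⟩
      rw [generators_eq_gens]
      exact hσ
  rw [this, Finset.sum_map]
  rfl

/-- Each permutation preserves the norm, so `2xy ≤ x² + y²` bounds each summand. This shows that no
eigenvalue exceeds the degree, and also bounds the contribution of a single generator. -/
theorem sum_mul_sum_perm_le {κ ι : Type*} [Fintype ι] (s : Finset κ) (p : κ → Perm ι)
    (v : ι → ℝ) :
    ∑ i, v i * ∑ σ ∈ s, v (p σ i) ≤ s.card * ∑ i, v i * v i := by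
  have h0 : ∑ i, v i * ∑ σ ∈ s, v (p σ i) = ∑ σ ∈ s, ∑ i, v i * v (p σ i) := by
    simp only [Finset.mul_sum]
    exact Finset.sum_comm
  rw [h0, ← nsmul_eq_mul]
  refine Finset.sum_le_card_nsmul _ _ _ fun σ _ => ?_
  have h : ∑ i, v (p σ i) * v (p σ i) = ∑ i, v i * v i :=
    Equiv.sum_comp (p σ) fun i => v i * v i
  have h2 : ∑ i, 2 * (v i * v (p σ i)) ≤ ∑ i, (v i * v i + v (p σ i) * v (p σ i)) :=
    Finset.sum_le_sum fun i _ => by nlinarith [sq_nonneg (v i - v (p σ i))]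
  rw [Finset.sum_add_distrib, h, ← Finset.mul_sum] at h2
  linarith

section RowSums

variable {m : ℕ} (hn : 4 ≤ m + 4)

theorem quotientQ_mulVec_one :
    quotientQ hn *ᵥ (1 : Fin (m + 4) → ℝ) = ((m : ℝ) + 4) • (1 : Fin (m + 4) → ℝ) := by
  ext i
  rw [quotientQ_mulVec]
  simp [card_gens]
  ring

theorem quotientQ_form_le (v : Fin (m + 4) → ℝ) :
    v ⬝ᵥ quotientQ hn *ᵥ v ≤ ((m : ℝ) + 4) * (v ⬝ᵥ v) := by
  simp only [dotProduct, quotientQ_mulVec]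
  refine (sum_mul_sum_perm_le (gens (m + 1)) (fun σ => σ) v).trans_eq ?_
  rw [card_gens]
  push_cast
  ring

open Classical in
theorem adjMatrix_mulVec_one : (cayleyGenerators hn).adjMatrix ℝ *ᵥ 1 =
    ((m : ℝ) + 4) • (1 : Perm (Fin (m + 4)) → ℝ) := by
  ext g
  rw [adjMatrix_mulVec]
  simp [card_gens]
  ring

open Classical in
theorem adjMatrix_form_le (f : Perm (Fin (m + 4)) → ℝ) :
    f ⬝ᵥ (cayleyGenerators hn).adjMatrix ℝ *ᵥ f ≤ ((m : ℝ) + 4) * (f ⬝ᵥ f) := by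
  simp only [dotProduct, adjMatrix_mulVec]
  refine (sum_mul_sum_perm_le (gens (m + 1)) (fun σ => Equiv.mulLeft σ) f).trans_eq ?_
  rw [card_gens]
  push_cast
  ring

end RowSums

/-! ### The rows of the quotient matrix -/

theorem coe_doubleSwap (m i : ℕ) (hi : i < m + 4) : (doubleSwap m ⟨i, hi⟩ : ℕ) =
    if i = 0 then 1 else if i = 1 then 0 else if i = m + 2 then m + 3 else
      if i = m + 3 then m + 2 else i := by
  simp only [doubleSwap, Perm.mul_apply, swap_apply_def, Fin.mk.injEq]
  split_ifs <;> simp_all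

theorem sum_gens_succ_apply (w : ℕ → ℝ) (m i : ℕ) (hi : i < m + 3) :
    ∑ σ ∈ gens (m + 1), w (σ ⟨i, by omega⟩) =
      w (doubleSwap m ⟨i, by omega⟩) + ∑ σ ∈ gens m, w (σ ⟨i, hi⟩) := by
  rw [sum_gens_succ m fun σ => w (σ ⟨i, by omega⟩)]
  congr 1
  refine Finset.sum_congr rfl fun σ _ => ?_
  exact congrArg (fun x : Fin (m + 4) => w x) (fixLast_castSucc σ ⟨i, hi⟩)

theorem sum_gens_apply_zero (w : ℕ → ℝ) (m : ℕ) :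
    ∑ σ ∈ gens m, w (σ ⟨0, by omega⟩) = (m + 1) * w 1 + 2 * w 2 := by
  induction m with
  | zero =>
    rw [sum_gens_zero fun σ => w (σ ⟨0, by omega⟩)]
    simp [swap_apply_def]
    ring
  | succ m ih =>
    rw [sum_gens_succ_apply w m 0 (by omega), ih, coe_doubleSwap]
    push_cast
    ring

theorem sum_gens_apply_one (w : ℕ → ℝ) (m : ℕ) :
    ∑ σ ∈ gens m, w (σ ⟨1, by omega⟩) = (m + 1) * w 0 + w 1 + w 2 := by
  induction m with
  | zero =>
    rw [sum_gens_zero fun σ => w (σ ⟨1, by omega⟩)]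
    simp [swap_apply_def]
    ring
  | succ m ih =>
    rw [sum_gens_succ_apply w m 1 (by omega), ih, coe_doubleSwap]
    push_cast
    ring

theorem sum_gens_apply_two (w : ℕ → ℝ) (m : ℕ) :
    ∑ σ ∈ gens (m + 1), w (σ ⟨2, by omega⟩) = 2 * w 0 + w 1 + w 3 + m * w 2 := by
  induction m with
  | zero =>
    rw [sum_gens_succ_apply w 0 2 (by omega), sum_gens_zero fun σ => w (σ ⟨2, by omega⟩),
      coe_doubleSwap]
    simp [swap_apply_def]
    ring
  | succ m ih =>
    rw [sum_gens_succ_apply w (m + 1) 2 (by omega), ih, coe_doubleSwap]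
    push_cast
    ring

theorem sum_gens_apply_last (w : ℕ → ℝ) (m : ℕ) :
    ∑ σ ∈ gens (m + 1), w (σ ⟨m + 3, by omega⟩) = (m + 3) * w (m + 3) + w (m + 2) := by
  rw [sum_gens_succ m fun σ => w (σ ⟨m + 3, by omega⟩), coe_doubleSwap]
  have : ∀ σ ∈ gens m, w (fixLast (m + 3) σ ⟨m + 3, by omega⟩) = w (m + 3) := fun σ _ =>
    congrArg (fun x : Fin (m + 4) => w x) (fixLast_last σ)
  rw [Finset.sum_congr rfl this]
  simp [card_gens]
  ring

theorem sum_gens_apply_mid (w : ℕ → ℝ) (m i : ℕ) (h3 : 3 ≤ i) (hi : i < m + 2) :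
    ∑ σ ∈ gens m, w (σ ⟨i, by omega⟩) = (m + 1) * w i + w (i - 1) + w (i + 1) := by
  induction m with
  | zero => omega
  | succ m ih =>
    rw [sum_gens_succ_apply w m i (by omega), coe_doubleSwap, if_neg (by omega),
      if_neg (by omega)]
    rcases Nat.lt_or_ge i (m + 2) with h | h
    · rw [ih h, if_neg (by omega), if_neg (by omega)]
      push_cast
      ring
    -- Here `i` was the last position one stage earlier, and the new generator is the one moving it
    -- to `i + 1`.
    · obtain ⟨k, rfl⟩ : ∃ k, m = k + 1 := ⟨m - 1, by omega⟩
      obtain rfl : i = k + 3 := by omega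
      rw [sum_gens_apply_last, if_pos (by omega)]
      push_cast
      ring

/-- For an involution `τ`, `∑ w·(w ∘ τ) = ∑ w² - ½ ∑ (w - w ∘ τ)²`, and each transposition
contributes its square twice. -/
theorem sum_mul_doubleSwap (w : ℕ → ℝ) (m : ℕ) :
    ∑ i : Fin (m + 4), w i * w (doubleSwap m i) =
      ∑ i : Fin (m + 4), w i * w i - (w 0 - w 1) ^ 2 - (w (m + 2) - w (m + 3)) ^ 2 := by
  have h : ∀ i : Fin (m + 4), (doubleSwap m i : ℕ) = if (i : ℕ) = 0 then 1 else
      if (i : ℕ) = 1 then 0 else if (i : ℕ) = m + 2 then m + 3 else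
      if (i : ℕ) = m + 3 then m + 2 else (i : ℕ) := fun i => coe_doubleSwap m i i.2
  have hmid : ∀ i : Fin m, ¬ (i : ℕ) = m ∧ ¬ (i : ℕ) = m + 1 := fun i => by omega
  simp only [h, Fin.sum_univ_castSucc (n := m + 3), Fin.sum_univ_castSucc (n := m + 2),
    Fin.sum_univ_succ (n := m + 1), Fin.sum_univ_succ (n := m)]
  simp [hmid]
  ring

theorem sum_gens_form_succ (w : ℕ → ℝ) (m : ℕ) :
    ∑ i : Fin (m + 4), w i * ∑ σ ∈ gens (m + 1), w (σ i) =
      ∑ i : Fin (m + 3), w i * ∑ σ ∈ gens m, w (σ i) + (m + 3) * w (m + 3) ^ 2 +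
      (∑ i : Fin (m + 4), w i * w i - (w 0 - w 1) ^ 2 - (w (m + 2) - w (m + 3)) ^ 2) := by
  rw [← sum_mul_doubleSwap]
  simp only [sum_gens_succ m fun σ => w (σ _), mul_add, Finset.sum_add_distrib]
  rw [Fin.sum_univ_castSucc (fun i : Fin (m + 4) => w i * ∑ σ ∈ gens m, w (fixLast (m + 3) σ i))]
  simp [card_gens]
  ring

/-! ### Monotonicity of the second eigenvalue of the quotient matrix -/

/-- `λ₂` of the quotient matrix for `n = m + 4`. -/
noncomputable def quotientEigenvalue (m : ℕ) : ℝ :=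
  secondEigenvalue (quotientQ (n := m + 4) (by omega)) (isHermitian_quotientQ _)
    (one_lt_card_fin (by omega))

theorem rayleigh_quotientEigenvalue (m : ℕ) (w : ℕ → ℝ) :
    ∑ i : Fin (m + 4), w i * ∑ σ ∈ gens (m + 1), w (σ i) ≤
      quotientEigenvalue m * ∑ i : Fin (m + 4), w i * w i +
      (m + 4 - quotientEigenvalue m) * (∑ i : Fin (m + 4), w i) ^ 2 / (m + 4) := by
  have h := dotProduct_mulVec_le_of_sum (isHermitian_quotientQ (n := m + 4) (by omega))
    (one_lt_card_fin (by omega)) (quotientQ_mulVec_one _) (quotientQ_form_le _)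
    fun i : Fin (m + 4) => w i
  simpa [dotProduct, quotientQ_mulVec, quotientEigenvalue] using h

/-- An eigenvector, extended to `ℕ` by repeating its last entry. -/
theorem exists_eigenvector_quotientEigenvalue (m : ℕ) : ∃ w : ℕ → ℝ,
    0 < ∑ i : Fin (m + 4), w i * w i ∧ ∑ i : Fin (m + 4), w i = 0 ∧
    (∀ i (hi : i < m + 4), ∑ σ ∈ gens (m + 1), w (σ ⟨i, hi⟩) = quotientEigenvalue m * w i) ∧
    w (m + 4) = w (m + 3) := by
  obtain ⟨v, h0, hs, hv⟩ := exists_eigenvector_secondEigenvalue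
    (isHermitian_quotientQ (n := m + 4) (by omega)) (one_lt_card_fin (by omega))
    (quotientQ_mulVec_one _) (quotientQ_form_le _)
  let w : ℕ → ℝ := fun k => v ⟨min k (m + 3), by omega⟩
  have hwv : ∀ i : Fin (m + 4), w i = v i := fun i => by
    have : min (i : ℕ) (m + 3) = i := by omega
    simp [w, this]
  refine ⟨w, ?_, by simp only [hwv, hs], fun i hi => ?_, by simp [w]⟩
  · simp only [hwv]
    obtain ⟨i, hi⟩ := Function.ne_iff.mp h0
    exact Finset.sum_pos' (fun i _ => mul_self_nonneg _)
      ⟨i, Finset.mem_univ _, mul_self_pos.mpr hi⟩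
  · have : w i = v ⟨i, hi⟩ := hwv ⟨i, hi⟩
    simp only [hwv, this]
    rw [← quotientQ_mulVec (by omega), hv]
    rfl

theorem two_le_quotientEigenvalue_zero : 2 ≤ quotientEigenvalue 0 := by
  -- The indicator of the last position already gives `λ₂ ≥ 8/3`.
  let w : ℕ → ℝ := fun k => if k = 3 then 1 else 0
  have h := rayleigh_quotientEigenvalue 0 w
  have h3 : ∑ σ ∈ gens 1, w (σ 3) = _ := sum_gens_apply_last w 0
  have w0 : w 0 = 0 := by simp [w]
  have w1 : w 1 = 0 := by simp [w]
  have w2 : w 2 = 0 := by simp [w]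
  have w3 : w 3 = 1 := by simp [w]
  simp [Fin.sum_univ_four, w0, w1, w2, w3] at h h3
  linarith

theorem quotientEigenvalue_succ_ge (m : ℕ) : m + 5 - 5 / 6 ≤ quotientEigenvalue (m + 1) := by
  -- The indicator of the last two positions gives, with `N = m + 5`, `N - λ₂ ≤ N / (2N - 4)`, which
  -- is at most `5/6` because `N ≥ 5`.
  let w : ℕ → ℝ := fun k => if m + 3 ≤ k then 1 else 0
  have h := rayleigh_quotientEigenvalue (m + 1) w
  have hL : ∑ σ ∈ gens (m + 2), w (σ (Fin.last (m + 4))) = m + 5 := by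
    have := sum_gens_apply_last w (m + 1)
    refine this.trans ?_
    simp [w]
    ring
  have hL' : ∑ σ ∈ gens (m + 2), w (σ (Fin.last (m + 3)).castSucc) = m + 4 := by
    have := sum_gens_apply_mid w (m + 2) (m + 3) (by omega) (by omega)
    refine this.trans ?_
    simp [w]
    ring
  have hz : ∀ i : Fin (m + 3), w i = 0 := fun i => if_neg (by omega)
  have h1 : ∀ k, w (m + 3 + k) = 1 := fun k => if_pos (by omega)
  have h10 := h1 0
  have h11 := h1 1
  simp only [Fin.sum_univ_castSucc (n := m + 4), Fin.sum_univ_castSucc (n := m + 3)] at h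
  rw [hL, hL'] at h
  simp [hz, h10, h11] at h
  have hN : (0 : ℝ) < m + 1 + 4 := by positivity
  rw [← sub_le_iff_le_add', le_div_iff₀ hN] at h
  have hm : (0 : ℝ) ≤ m := by positivity
  by_contra hlt
  push Not at hlt
  nlinarith

/-- Settles the step from `n = 4` to `n = 5`: the gap `n - λ₂` is at least `5/6` at `n = 4` and at
most `5/6` at `n = 5`. -/
theorem quotientEigenvalue_zero_le : quotientEigenvalue 0 ≤ 4 - 5 / 6 := by
  obtain ⟨w, h0, hs, hw, -⟩ := exists_eigenvector_quotientEigenvalue 0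
  have r0 := hw 0 (by omega)
  have r1 := hw 1 (by omega)
  have r2 := hw 2 (by omega)
  have r3 := hw 3 (by omega)
  rw [sum_gens_apply_zero] at r0
  rw [sum_gens_apply_one] at r1
  rw [sum_gens_apply_two] at r2
  rw [sum_gens_apply_last w 0] at r3
  simp [Fin.sum_univ_four] at h0 hs r0 r1 r2 r3
  obtain ⟨a, ha⟩ : ∃ a, a = w 0 := ⟨_, rfl⟩
  obtain ⟨b, hb⟩ : ∃ b, b = w 1 := ⟨_, rfl⟩
  obtain ⟨c, hc⟩ : ∃ c, c = w 2 := ⟨_, rfl⟩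
  have hd : w 3 = -(a + b + c) := by linarith
  simp only [hd, ← ha, ← hb, ← hc] at h0 r0 r1 r2 r3
  refine le_of_mul_le_mul_right ?_ h0
  have hq : quotientEigenvalue 0 * (a * a + b * b + c * c + -(a + b + c) * -(a + b + c)) =
      b * b + 3 * (a + b + c) ^ 2 + 4 * a * b + 4 * a * c + 2 * b * c - 2 * c * (a + b + c) := by
    linear_combination -a * r0 - b * r1 - c * r2 + (a + b + c) * r3
  rw [hq]
  -- The squares come from completing the square successively in `a`, `b`, `c` in `19/6` times the
  -- norm minus the form.
  nlinarith [sq_nonneg (a - 11 / 20 * b - 1 / 4 * c), sq_nonneg (b - 35 / 159 * c), sq_nonneg c]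

/-- Along the path of positions from `2` on, the three-term recurrence has a conserved quadratic
form, which bounds `w 2` by the last entry. The rows of positions `0` and `1` then make `w 0 - w 1`
a small multiple of `w 2`. -/
theorem sq_sub_le_of_recurrence {w : ℕ → ℝ} {m : ℕ} (hm : 1 ≤ m) {ε : ℝ} (h0 : 0 ≤ ε)
    (h1 : ε ≤ 5 / 6) (e0 : (m + 2) * w 1 + 2 * w 2 = (m + 4 - ε) * w 0)
    (e1 : (m + 2) * w 0 + w 1 + w 2 = (m + 4 - ε) * w 1)
    (e2 : ∀ i, 3 ≤ i → i < m + 3 →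
      (m + 2) * w i + w (i - 1) + w (i + 1) = (m + 4 - ε) * w i)
    (e3 : (m + 3) * w (m + 3) + w (m + 2) = (m + 4 - ε) * w (m + 3)) :
    (w 0 - w 1) ^ 2 * (m + 5) ≤ ε * w (m + 3) ^ 2 * (m + 4) := by
  have hI : ∀ k, k ≤ m → w 2 ^ 2 + w 3 ^ 2 - (2 - ε) * w 2 * w 3 =
      w (k + 2) ^ 2 + w (k + 3) ^ 2 - (2 - ε) * w (k + 2) * w (k + 3) := by
    intro k
    induction k with
    | zero => intro _; rfl
    | succ k ih =>
      intro hk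
      rw [ih (by omega)]
      have := e2 (k + 3) (by omega) (by omega)
      have h : w (k + 4) = (2 - ε) * w (k + 3) - w (k + 2) := by
        simp only [Nat.add_succ_sub_one] at this
        linarith
      have a1 : k + 1 + 2 = k + 3 := rfl
      have a2 : k + 1 + 3 = k + 4 := rfl
      rw [a1, a2, h]
      ring
  have hIm := hI m le_rfl
  have h2 : w (m + 2) = (1 - ε) * w (m + 3) := by linarith
  rw [h2] at hIm
  -- The invariant equals `ε * w (m + 3) ^ 2` at the far end and `(w 3 - (1 - ε/2) w 2)² + ε (1 -
  -- ε/4) (w 2)²` at the near end.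
  have hw : ε * ((1 - ε / 4) * w 2 ^ 2) ≤ ε * w (m + 3) ^ 2 := by
    nlinarith [sq_nonneg (w 3 - (1 - ε / 2) * w 2)]
  set M : ℝ := (m : ℝ) with hM
  have hM1 : (1 : ℝ) ≤ M := by rw [hM]; exact_mod_cast hm
  set d := w 0 - w 1 with hd
  set D := (3 * (M + 4) - 4) - (2 * (M + 4) - 1) * ε + ε ^ 2 with hD
  -- Eliminating `w 0` and `w 1` from the first two rows produces `D`; the bound `ε ≤ 5/6` keeps it
  -- at least `3`.
  have hdD : d * D = -(ε * w 2) := by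
    have hA : (1 - ε) * w 1 = w 2 + (M + 2) * d := by rw [hd]; linarith
    have hB : w 2 - w 1 = (2 * (M + 4) - 2 - ε) * d := by rw [hd]; linarith
    have hC : w 1 = w 2 - (2 * (M + 4) - 2 - ε) * d := by linarith
    rw [hC] at hA
    rw [hD]
    linarith
  have hDpos : 3 + (M - 1) ≤ D := by
    rw [hD]
    nlinarith [sq_nonneg ε]
  have h3 : d ^ 2 * D ^ 2 * (1 - ε / 4) ≤ ε ^ 2 * w (m + 3) ^ 2 := by
    have : d ^ 2 * D ^ 2 = ε ^ 2 * w 2 ^ 2 := by rw [← mul_pow, hdD]; ring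
    rw [this]
    nlinarith
  have h4 : ε * (M + 5) ≤ D ^ 2 * (1 - ε / 4) * (M + 4) := by
    have hD2 : 9 ≤ D ^ 2 := by nlinarith
    have h5 : 9 * (19 / 24) ≤ D ^ 2 * (1 - ε / 4) :=
      mul_le_mul hD2 (by linarith) (by norm_num) (by positivity)
    have h6 : ε * (M + 5) ≤ 5 / 6 * (M + 5) := by gcongr
    have h7 : 9 * (19 / 24) * (M + 4) ≤ D ^ 2 * (1 - ε / 4) * (M + 4) := by gcongr
    linarith
  have hK : 0 < D ^ 2 * (1 - ε / 4) := by
    have : 0 < D := by linarith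
    have : 0 < 1 - ε / 4 := by linarith
    positivity
  refine le_of_mul_le_mul_left ?_ hK
  calc D ^ 2 * (1 - ε / 4) * (d ^ 2 * (M + 5)) = (d ^ 2 * D ^ 2 * (1 - ε / 4)) * (M + 5) := by ring
    _ ≤ ε ^ 2 * w (m + 3) ^ 2 * (M + 5) := by gcongr
    _ = (ε * w (m + 3) ^ 2) * (ε * (M + 5)) := by ring
    _ ≤ (ε * w (m + 3) ^ 2) * (D ^ 2 * (1 - ε / 4) * (M + 4)) := by gcongr
    _ = _ := by ring

theorem quotientEigenvalue_add_one_le (m : ℕ) :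
    quotientEigenvalue m + 1 ≤ quotientEigenvalue (m + 1) := by
  rcases Nat.eq_zero_or_pos m with rfl | hm
  · have h1 := quotientEigenvalue_succ_ge 0
    have h2 := quotientEigenvalue_zero_le
    norm_num at h1 h2
    linarith
  obtain ⟨w, hnorm, hsum, hw, hlast⟩ := exists_eigenvector_quotientEigenvalue m
  obtain ⟨ε, hε⟩ : ∃ ε, ε = m + 4 - quotientEigenvalue m := ⟨_, rfl⟩
  have hμ : quotientEigenvalue m = m + 4 - ε := by linarith
  have hform : ∑ i : Fin (m + 4), w i * ∑ σ ∈ gens (m + 1), w (σ i) =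
      quotientEigenvalue m * ∑ i : Fin (m + 4), w i * w i := by
    rw [Finset.mul_sum]
    refine Finset.sum_congr rfl fun i _ => ?_
    have := hw i i.2
    simp only [Fin.eta] at this
    rw [this]
    ring
  have hε0 : 0 ≤ ε := by
    have := sum_mul_sum_perm_le (gens (m + 1)) (fun σ => σ) fun i : Fin (m + 4) => w i
    rw [hform, card_gens, hμ] at this
    have := le_of_mul_le_mul_right this hnorm
    push_cast at this
    linarith
  have hε1 : ε ≤ 5 / 6 := by
    obtain ⟨k, rfl⟩ : ∃ k, m = k + 1 := ⟨m - 1, by omega⟩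
    have := quotientEigenvalue_succ_ge k
    push_cast at hμ
    linarith
  have hd : (w 0 - w 1) ^ 2 * (m + 5) ≤ ε * w (m + 3) ^ 2 * (m + 4) := by
    refine sq_sub_le_of_recurrence hm hε0 hε1 ?_ ?_ ?_ ?_
    · rw [← hμ, ← hw 0 (by omega), sum_gens_apply_zero]
      push_cast; ring
    · rw [← hμ, ← hw 1 (by omega), sum_gens_apply_one]
      push_cast; ring
    · intro i h3 hi
      rw [← hμ, ← hw i (by omega), sum_gens_apply_mid w (m + 1) i h3 (by omega)]
      push_cast; ring
    · rw [← hμ, ← hw (m + 3) (by omega), sum_gens_apply_last]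
  -- Since `w (m + 4) = w (m + 3)`, the new transposition at the end costs nothing; the only loss is
  -- `(w 0 - w 1)²`.
  have hR := rayleigh_quotientEigenvalue (m + 1) w
  rw [sum_gens_form_succ w (m + 1)] at hR
  rw [hform] at hR
  have e1 : m + 1 + 3 = m + 4 := rfl
  have e2 : m + 1 + 2 = m + 3 := rfl
  rw [Fin.sum_univ_castSucc (fun i : Fin (m + 1 + 4) => w i * w i),
    Fin.sum_univ_castSucc (fun i : Fin (m + 1 + 4) => w i)] at hR
  simp only [Fin.val_castSucc, Fin.val_last, e1, e2, hsum, hlast, hμ] at hR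
  set S := ∑ i : Fin (m + 4), w i * w i with hS
  set t := w (m + 3) with ht
  set d := w 0 - w 1 with hdd
  set ν := quotientEigenvalue (m + 1) with hν
  push_cast at hR
  set M : ℝ := (m : ℝ) with hM
  have hM0 : 0 ≤ M := by rw [hM]; positivity
  have hpos : 0 < S * (M + 5) + t ^ 2 * (M + 4) := by positivity
  -- The extended vector has squared norm `S + t²` and sum `t`; after removing its mean and clearing
  -- denominators, the bracket is its squared norm, and `hd` absorbs the loss.
  have hR' : (M + 5 - ν) * (S * (M + 5) + t ^ 2 * (M + 4)) ≤
      ε * (S * (M + 5) + t ^ 2 * (M + 4)) := by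
    have h5 : (0 : ℝ) < M + 1 + 4 := by positivity
    rw [← sub_le_iff_le_add', le_div_iff₀ h5] at hR
    nlinarith
  have := le_of_mul_le_mul_right hR' hpos
  linarith

/-! ### Restriction to the stabiliser of the last symbol -/

theorem bijective_fixLast_mul_swap (n : ℕ) :
    Function.Bijective fun p : Fin (n + 1) × Perm (Fin n) =>
      fixLast n p.2 * swap p.1 (Fin.last n) := by
  rw [Fintype.bijective_iff_injective_and_card]
  constructor
  · rintro ⟨i, σ⟩ ⟨j, τ⟩ h
    simp only at h
    obtain rfl : i = j := by
      have h1 := congrArg (fun ρ => ρ i) h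
      simp only [Perm.mul_apply, swap_apply_left, fixLast_last] at h1
      have h2 : swap j (Fin.last n) i = Fin.last n :=
        (fixLast n τ).injective (by rw [← h1, fixLast_last])
      simpa using congrArg (swap j (Fin.last n)) h2
    rw [fixLast_injective n (mul_right_cancel h)]
  · simp [Fintype.card_perm, Nat.factorial_succ]

theorem sum_perm_succ {n : ℕ} (F : Perm (Fin (n + 1)) → ℝ) :
    ∑ g, F g = ∑ i, ∑ h, F (fixLast n h * swap i (Fin.last n)) := by
  rw [← (bijective_fixLast_mul_swap n).sum_comp F, Fintype.sum_prod_type]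

theorem fixLast_mul_swap_apply_eq_last {n : ℕ} (h : Perm (Fin n)) (i j : Fin (n + 1)) :
    (fixLast n h * swap i (Fin.last n)) j = Fin.last n ↔ j = i := by
  rw [← fixLast_last h, Perm.mul_apply, (fixLast n h).injective.eq_iff, fixLast_last,
    Equiv.swap_apply_eq_iff, swap_apply_right]

/-- Left multiplication by `Stab(last)` preserves each right coset `{g | g i = last}`, so `hc`
applies coset by coset; `doubleSwap` accounts for the extra `1`. -/
theorem form_le_of_restriction {m : ℕ} {c : ℝ}
    (hc : ∀ f : Perm (Fin (m + 3)) → ℝ, ∑ g, f g = 0 →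
      ∑ g, f g * ∑ σ ∈ gens m, f (σ * g) ≤ c * ∑ g, f g * f g)
    {f : Perm (Fin (m + 4)) → ℝ}
    (hf : ∀ i, ∑ g, (if g i = Fin.last (m + 3) then f g else 0) = 0) :
    ∑ g, f g * ∑ σ ∈ gens (m + 1), f (σ * g) ≤ (c + 1) * ∑ g, f g * f g := by
  simp only [sum_gens_succ m fun σ => f (σ * _), mul_add, Finset.sum_add_distrib]
  have h1 : ∑ g, f g * f (doubleSwap m * g) ≤ ∑ g, f g * f g := by
    have := sum_mul_sum_perm_le {doubleSwap m} (fun σ => Equiv.mulLeft σ) f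
    simpa using this
  have h2 : ∑ g, f g * ∑ σ ∈ gens m, f (fixLast (m + 3) σ * g) ≤ c * ∑ g, f g * f g := by
    rw [sum_perm_succ, sum_perm_succ (fun g => f g * f g), Finset.mul_sum]
    refine Finset.sum_le_sum fun i _ => ?_
    have := hc (fun h => f (fixLast (m + 3) h * swap i (Fin.last (m + 3)))) ?_
    · simpa only [map_mul, mul_assoc] using this
    · have h := hf i
      rw [sum_perm_succ] at h
      simp only [fixLast_mul_swap_apply_eq_last] at h
      rw [Finset.sum_comm] at h
      simpa using h
  linarith

/-- On the sign character the two 3-cycles and the transposition act as `2 - 1 = 1`; on functions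
with zero mean on both cosets of `A_3` the 3-cycles sum to `-1` and the transposition adds at most
`1`. -/
theorem form_le_of_symm_three {f : Perm (Fin 3) → ℝ} (hf : ∑ g, f g = 0) :
    ∑ g, f g * ∑ σ ∈ gens 0, f (σ * g) ≤ 1 * ∑ g, f g * f g := by
  obtain ⟨c, hc⟩ : ∃ c : Perm (Fin 3), c = swap 0 1 * swap 1 2 := ⟨_, rfl⟩
  obtain ⟨c2, hc2⟩ : ∃ c2 : Perm (Fin 3), c2 = swap 0 2 * swap 2 1 := ⟨_, rfl⟩
  obtain ⟨s, hs⟩ : ∃ s : Perm (Fin 3), s = swap 0 1 := ⟨_, rfl⟩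
  obtain ⟨t, ht⟩ : ∃ t : Perm (Fin 3), t = swap 0 2 := ⟨_, rfl⟩
  obtain ⟨u, hu⟩ : ∃ u : Perm (Fin 3), u = swap 1 2 := ⟨_, rfl⟩
  have hmul : (c * c = c2 ∧ c * c2 = 1 ∧ c * s = t ∧ c * t = u ∧ c * u = s ∧
      c2 * c = 1 ∧ c2 * c2 = c ∧ c2 * s = u ∧ c2 * t = s ∧ c2 * u = t ∧
      t * c = s ∧ t * c2 = u ∧ t * s = c ∧ t * t = 1 ∧ t * u = c2) := by
    subst hc hc2 hs ht hu
    decide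
  have hsum : ∀ F : Perm (Fin 3) → ℝ,
      ∑ g, F g = F 1 + (F c + (F c2 + (F s + (F t + F u)))) := by
    intro F
    have huniv : (Finset.univ : Finset (Perm (Fin 3))) = {1, c, c2, s, t, u} := by
      subst hc hc2 hs ht hu
      decide
    have hne : 1 ∉ ({c, c2, s, t, u} : Finset (Perm (Fin 3))) ∧
        c ∉ ({c2, s, t, u} : Finset (Perm (Fin 3))) ∧
        c2 ∉ ({s, t, u} : Finset (Perm (Fin 3))) ∧ s ∉ ({t, u} : Finset (Perm (Fin 3))) ∧
        t ∉ ({u} : Finset (Perm (Fin 3))) := by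
      subst hc hc2 hs ht hu
      decide
    rw [huniv, Finset.sum_insert hne.1, Finset.sum_insert hne.2.1,
      Finset.sum_insert hne.2.2.1, Finset.sum_insert hne.2.2.2.1,
      Finset.sum_insert hne.2.2.2.2, Finset.sum_singleton]
  rw [hsum] at hf
  rw [hsum, hsum]
  simp only [sum_gens_zero, ← hc, ← hc2]
  simp only [← ht, mul_one, hmul]
  -- The mean over `A_3`; the mean over the odd permutations is then `-a`.
  obtain ⟨a, ha⟩ : ∃ a, a = (f 1 + f c + f c2) / 3 := ⟨_, rfl⟩
  have h1 : f 1 = 3 * a - f c - f c2 := by linarith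
  have h2 : f t = -(3 * a) - f s - f u := by linarith
  clear hf
  generalize f 1 = x at ha h1 ⊢
  generalize f t = y at h2 ⊢
  clear ha
  subst h1 h2
  nlinarith [sq_nonneg (3 * a - f c - f c2 - (-(3 * a) - f s - f u) - 2 * a), sq_nonneg (f c - f s - 2 * a),
    sq_nonneg (f c2 - f u - 2 * a), sq_nonneg (2 * a - f c - f c2), sq_nonneg (f c - a),
    sq_nonneg (f c2 - a), sq_nonneg (f s + a), sq_nonneg (-(3 * a) - f s - f u + a), sq_nonneg (f u + a)]

/-! ### The second eigenvalue of the Cayley graph -/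

/-- `λ₂` of the Cayley graph for `n = m + 4`. -/
noncomputable def cayleyEigenvalue (m : ℕ) : ℝ :=
  graphSecondEigenvalue (cayleyGenerators (n := m + 4) (by omega)) (one_lt_card_perm (by omega))

theorem rayleigh_cayleyEigenvalue {m : ℕ} {f : Perm (Fin (m + 4)) → ℝ} (hf : ∑ g, f g = 0) :
    ∑ g, f g * ∑ σ ∈ gens (m + 1), f (σ * g) ≤ cayleyEigenvalue m * ∑ g, f g * f g := by
  classical
  have h := dotProduct_mulVec_le_secondEigenvalue
    (isHermitian_adjMatrix (cayleyGenerators (n := m + 4) (by omega)))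
    (one_lt_card_perm (by omega)) (adjMatrix_mulVec_one _) (adjMatrix_form_le _) hf
  simp only [dotProduct, adjMatrix_mulVec] at h
  exact h

theorem exists_eigenvector_cayleyEigenvalue (m : ℕ) : ∃ f : Perm (Fin (m + 4)) → ℝ,
    f ≠ 0 ∧ ∑ g, f g = 0 ∧
    ∀ g, ∑ σ ∈ gens (m + 1), f (σ * g) = cayleyEigenvalue m * f g := by
  classical
  obtain ⟨f, h0, hs, hf⟩ := exists_eigenvector_secondEigenvalue
    (isHermitian_adjMatrix (cayleyGenerators (n := m + 4) (by omega)))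
    (one_lt_card_perm (by omega)) (adjMatrix_mulVec_one _) (adjMatrix_form_le _)
  refine ⟨f, h0, hs, fun g => ?_⟩
  rw [← adjMatrix_mulVec (by omega), hf]
  rfl

/-- The constant is the order of a point stabiliser, the common size of the fibres of `g ↦ g 0`;
only its positivity matters. -/
theorem exists_sum_perm_apply_zero_eq {n : ℕ} : ∃ c : ℝ, 0 < c ∧ ∀ F : Fin (n + 1) → ℝ,
    ∑ g : Perm (Fin (n + 1)), F (g 0) = c * ∑ i, F i := by
  refine ⟨∑ g : Perm (Fin (n + 1)), if g 0 = 0 then 1 else 0, ?_, fun F => ?_⟩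
  · exact Finset.sum_pos' (fun g _ => by split_ifs <;> norm_num)
      ⟨1, Finset.mem_univ _, by simp⟩
  · have h : ∀ g : Perm (Fin (n + 1)), F (g 0) = ∑ i, if g 0 = i then F i else 0 := by simp
    simp only [h]
    rw [Finset.sum_comm, Finset.mul_sum]
    refine Finset.sum_congr rfl fun i _ => ?_
    rw [← Equiv.sum_comp (Equiv.mulLeft (swap 0 i)), Finset.sum_mul]
    refine Finset.sum_congr rfl fun g _ => ?_
    simp [Equiv.swap_apply_eq_iff]

theorem quotientEigenvalue_le_cayleyEigenvalue (m : ℕ) :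
    quotientEigenvalue m ≤ cayleyEigenvalue m := by
  obtain ⟨w, h0, hs, hw, -⟩ := exists_eigenvector_quotientEigenvalue m
  obtain ⟨c, hc0, hc⟩ := exists_sum_perm_apply_zero_eq (n := m + 3)
  have h := rayleigh_cayleyEigenvalue (f := fun g => w (g 0)) (by
    rw [hc fun i => w i, hs, mul_zero])
  simp only [Perm.mul_apply] at h
  rw [hc fun i => w i * ∑ σ ∈ gens (m + 1), w (σ i), hc fun i => w i * w i] at h
  have hw' : ∑ i : Fin (m + 4), w i * ∑ σ ∈ gens (m + 1), w (σ i) =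
      quotientEigenvalue m * ∑ i : Fin (m + 4), w i * w i := by
    rw [Finset.mul_sum]
    refine Finset.sum_congr rfl fun i _ => ?_
    rw [hw i i.2]
    ring
  rw [hw', mul_left_comm] at h
  exact le_of_mul_le_mul_right h (mul_pos hc0 h0)

/-- The push-forward `P` of `f` along `g ↦ g i` intertwines left multiplication on `S_n` with the
action on positions. It is therefore a sum-zero vector with `Q P = c P`, nonzero at `j`. -/
theorem eigenvalue_le_of_coset_sum_ne_zero {m : ℕ} {c : ℝ} {f : Perm (Fin (m + 4)) → ℝ}
    (hs : ∑ g, f g = 0) (hf : ∀ g, ∑ σ ∈ gens (m + 1), f (σ * g) = c * f g)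
    {i j : Fin (m + 4)} (hij : ∑ g, (if g i = j then f g else 0) ≠ 0) :
    c ≤ quotientEigenvalue m := by
  let P : Fin (m + 4) → ℝ := fun k => ∑ g, (if g i = k then f g else 0)
  have hP : ∀ k, ∑ σ ∈ gens (m + 1), P (σ k) = c * P k := by
    intro k
    have : ∀ σ : Perm (Fin (m + 4)), P (σ k) = ∑ g, (if g i = k then f (σ * g) else 0) := by
      intro σ
      simp only [P]
      rw [← Equiv.sum_comp (Equiv.mulLeft σ)]
      simp
    simp only [this]
    rw [Finset.sum_comm]
    simp only [P]
    rw [Finset.mul_sum]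
    refine Finset.sum_congr rfl fun g _ => ?_
    split_ifs
    · exact hf g
    · simp
  have hPs : ∑ k, P k = 0 := by
    simp only [P]
    rw [Finset.sum_comm]
    simpa using hs
  have h := dotProduct_mulVec_le_secondEigenvalue (isHermitian_quotientQ (n := m + 4) (by omega))
    (one_lt_card_fin (by omega)) (quotientQ_mulVec_one _) (quotientQ_form_le _) hPs
  have hQ : quotientQ (n := m + 4) (by omega) *ᵥ P = c • P := by
    ext k
    rw [quotientQ_mulVec, hP]
    rfl
  rw [hQ, dotProduct_smul, smul_eq_mul] at h
  refine le_of_mul_le_mul_right h ?_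
  exact Finset.sum_pos' (fun k _ => mul_self_nonneg _)
    ⟨j, Finset.mem_univ _, mul_self_pos.mpr hij⟩

theorem cayleyEigenvalue_le_of_restriction {m : ℕ} {c : ℝ}
    (hc : ∀ f : Perm (Fin (m + 3)) → ℝ, ∑ g, f g = 0 →
      ∑ g, f g * ∑ σ ∈ gens m, f (σ * g) ≤ c * ∑ g, f g * f g)
    (hcm : c + 1 ≤ quotientEigenvalue m) : cayleyEigenvalue m ≤ quotientEigenvalue m := by
  obtain ⟨f, h0, hs, hf⟩ := exists_eigenvector_cayleyEigenvalue m
  by_cases h : ∀ i, ∑ g, (if g i = Fin.last (m + 3) then f g else 0) = 0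
  · refine le_trans ?_ hcm
    have h1 := form_le_of_restriction hc h
    have h2 : ∑ g, f g * ∑ σ ∈ gens (m + 1), f (σ * g) =
        cayleyEigenvalue m * ∑ g, f g * f g := by
      rw [Finset.mul_sum]
      refine Finset.sum_congr rfl fun g _ => ?_
      rw [hf]
      ring
    rw [h2] at h1
    obtain ⟨g, hg⟩ := Function.ne_iff.mp h0
    exact le_of_mul_le_mul_right h1 (Finset.sum_pos' (fun g _ => mul_self_nonneg _)
      ⟨g, Finset.mem_univ _, mul_self_pos.mpr hg⟩)
  · push Not at h
    obtain ⟨i, hi⟩ := h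
    exact eigenvalue_le_of_coset_sum_ne_zero hs hf hi

theorem cayleyEigenvalue_le_quotientEigenvalue (m : ℕ) :
    cayleyEigenvalue m ≤ quotientEigenvalue m := by
  induction m with
  | zero =>
    refine cayleyEigenvalue_le_of_restriction (fun f => form_le_of_symm_three) ?_
    linarith [two_le_quotientEigenvalue_zero]
  | succ m ih =>
    refine cayleyEigenvalue_le_of_restriction (fun f => rayleigh_cayleyEigenvalue) ?_
    linarith [quotientEigenvalue_add_one_le m]

end FlagJohnson

theorem lemma2p4 (n : ℕ) (hn : 4 ≤ n) :
    FlagJohnson.graphSecondEigenvalue (FlagJohnson.cayleyGenerators hn)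
        (FlagJohnson.one_lt_card_perm hn) =
      FlagJohnson.secondEigenvalue (FlagJohnson.quotientQ hn)
        (FlagJohnson.isHermitian_quotientQ hn) (FlagJohnson.one_lt_card_fin hn) := by
  obtain ⟨m, rfl⟩ : ∃ m, n = m + 4 := ⟨n - 4, by omega⟩
  exact le_antisymm (FlagJohnson.cayleyEigenvalue_le_quotientEigenvalue m)
    (FlagJohnson.quotientEigenvalue_le_cayleyEigenvalue m)
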